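/- Work over $\mathbf C$. For $i=1,2$ let $Y^{(i)}$ be an $n$-dimensional toric variety with big torus $T_{Y^{(i)}}$, let $\mathcal V^{(i)}=\mathcal L^{(i)}_1\oplus\dots\oplus\mathcal L^{(i)}_r$ be a sum of line bundles on $Y^{(i)}$ (each $\mathcal L^{(i)}_k$ being the line bundle of a torus-invariant Cartier divisor), let $g^{(i)}=\ell^{(i)}_1+\dots+\ell^{(i)}_r$, $\ell^{(i)}_k\in\Gamma(Y^{(i)},\mathcal L_k^{(i)})$, be a global section, and let $Z^{(i)}\subseteq Y^{(i)}$ be its zero locus. Let $X^{(i)}$ be the total space of the dual bundle of $\mathcal V^{(i)}$, a toric variety. Assume that the tori of $X^{(1)}$ and $X^{(2)}$ are identified with one torus $T$ in such a way that the characters extending to global functions on $X^{(1)}$ and on $X^{(2)}$ are the same (so $X^{(1)}$ and $X^{(2)}$ have the same toric affinization), and that $g^{(1)}$ and $g^{(2)}$, considered as functions on $X^{(1)}$ and $X^{(2)}$, restrict to the same function $W=\sum_\chi c_\chi\chi$ on $T$. There are projections $\pi_i\colon T\to T_{Y^{(i)}}\subseteq Y^{(i)}$. Let $\Lambda^{(i)}_k$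 be the set of characters of $T$ that occur in the expansion of $\ell^{(i)}_k$, considered as a function on $T$, and assume: 1. $\Lambda^{(1)}_k\cap\Lambda^{(2)}_k\neq\varnothing$ for every $k$; 2. for $i=1,2$ the ratios $\chi/\chi'$ with $\chi,\chi'\in\Lambda^{(i)}_k$ for some $k$ generate the group of all characters of $T_{Y^{(i)}}$. Put $W_{ab}=\sum_{\chi\in\Lambda^{(1)}_a\cap\Lambda^{(2)}_b}c_\chi\chi$ and $(W)=(W_{ab})_{a,b}$. Let $D$ be the directed graph on $\{1,\dots,r\}$ with an arrow from $a$ to $b$ when $\Lambda^{(1)}_a\cap\Lambda^{(2)}_b\ne\varnothing$, let $D_{(1)},\dots,D_{(\beta)}$ be its connected components (ignoring directions), and let $$R^{(i)}=\{t\in T \mid \pi_i(t)\in Z^{(i)},\ \operatorname{rank}(W)(t)=r-\beta\},\qquad \Omega^{(i)}=\pi_i\bigl(R^{(1)}\cap R^{(2)}\bigr)\subseteq Z^{(i)} .$$ These are regarded as sets of complex points with their (reduced) variety structure. **Proposition ($O$ torsor).** Let $\lambda=(\lambda_j)_j\in\mathbf G_m^\beta$ act on $T$ by keeping $\pi_1$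 fixed and multiplying by $\lambda_j$ the $k$-th fibre coordinate of $X^{(1)}\to Y^{(1)}$ for every $k\in D_{(j)}$. This coincides with the action defined in the same way by $X^{(2)}\to Y^{(2)}$; it preserves $R^{(1)}\cap R^{(2)}$ and is an algebraic action of $\mathbf G_m^\beta$ on it. For $i=1,2$, the set $\Omega^{(i)}$ is Zariski open in $Z^{(i)}$, and there is an isomorphism of varieties $$R^{(1)}\cap R^{(2)}\;\cong\;\Omega^{(i)}\times\mathbf G_m^\beta$$ whose first component is $\pi_i$ and which is equivariant for $\mathbf G_m^\beta$ acting on the right-hand side trivially on $\Omega^{(i)}$ and by multiplication on $\mathbf G_m^\beta$. -/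

import Mathlib

noncomputable section

/-! Toric varieties, torus-invariant Cartier divisors and split bundles, through fans. -/

/-- The pairing of a real (co)vector with a vector of `N_ℝ = ℝⁿ`. -/
def pairing {n : ℕ} (m u : Fin n → ℝ) : ℝ := ∑ i, m i * u i

/-- An integral vector seen as a real vector. -/
def toReal {n : ℕ} (m : Fin n → ℤ) : Fin n → ℝ := fun i => (m i : ℝ)

/-- `τ` is a face of the cone `σ`: it is cut out of `σ` by a supporting hyperplane. -/
def IsConeFace {n : ℕ} (τ σ : PointedCone ℝ (Fin n → ℝ)) : Prop :=
  ∃ m : Fin n → ℝ, (∀ u ∈ σ, 0 ≤ pairing m u) ∧ ∀ u, u ∈ τ ↔ u ∈ σ ∧ pairing m u = 0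

/-- A fan of strongly convex rational polyhedral cones in `N_ℝ`, where `N = ℤⁿ`, that is, a
toric variety `Y` whose torus `T_Y` has character lattice `M = ℤⁿ`. -/
structure ToricFan (n : ℕ) where
  cones : Set (PointedCone ℝ (Fin n → ℝ))
  finite : cones.Finite
  nonempty : cones.Nonempty
  rational : ∀ σ ∈ cones, ∃ s : Finset (Fin n → ℤ),
    σ = Submodule.span {c : ℝ // 0 ≤ c} (toReal '' (s : Set (Fin n → ℤ)))
  stronglyConvex : ∀ σ ∈ cones, ∀ u ∈ σ, -u ∈ σ → u = 0
  face_mem : ∀ σ ∈ cones, ∀ τ, IsConeFace τ σ → τ ∈ cones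
  inter_face : ∀ σ ∈ cones, ∀ τ ∈ cones, IsConeFace (σ ⊓ τ) σ

/-- A torus-invariant Cartier divisor `D` on the toric variety of a fan, by its local data
`m_σ ∈ M`: on the affine chart of `σ`, the line bundle `𝒪(D)` is generated by `χ^{m_σ}`. -/
structure CartierDatum {n : ℕ} (Y : ToricFan n) where
  slope : Y.cones → (Fin n → ℤ)
  agree : ∀ σ τ : Y.cones, ∀ u ∈ σ.1 ⊓ τ.1,
    pairing (toReal (slope σ)) u = pairing (toReal (slope τ)) u

/-- The characters `m` that are global sections of `𝒪(D)`. -/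
def CartierDatum.sectionCharacters {n : ℕ} {Y : ToricFan n} (D : CartierDatum Y) :
    Set (Fin n → ℤ) :=
  {m | ∀ σ : Y.cones, ∀ u ∈ σ.1, pairing (toReal (D.slope σ)) u ≤ pairing (toReal m) u}

/-- A toric variety `Y`, a split bundle `𝒱 = ℒ_1 ⊕ ⋯ ⊕ ℒ_r` on it with `ℒ_k = 𝒪(D_k)`, and a
global section `g = ℓ_1 + ⋯ + ℓ_r`, given by the character expansions of the `ℓ_k`. -/
structure BundleWithSection (n r : ℕ) where
  Y : ToricFan n
  D : Fin r → CartierDatum Y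
  sec : Fin r → ((Fin n → ℤ) →₀ ℂ)
  sec_global : ∀ k, ∀ m ∈ (sec k).support, m ∈ (D k).sectionCharacters

namespace BundleWithSection

variable {n r : ℕ} (E : BundleWithSection n r)

/-- The characters of the torus of `X`, the total space of `𝒱^∨`, are pairs `(m, d)` with `m` a
character of `T_Y` and `d` the degrees in the fibre coordinates. Those that are global functions
on `X`, i.e. lie in `Γ(Y, Sym 𝒱)`, form this monoid. -/
def globalCharacters : Set ((Fin n → ℤ) × (Fin r → ℤ)) :=
  {p | (∀ k, 0 ≤ p.2 k) ∧ ∀ σ : E.Y.cones, ∀ u ∈ σ.1,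
    ∑ k, (p.2 k : ℝ) * pairing (toReal ((E.D k).slope σ)) u ≤ pairing (toReal p.1) u}

/-- The section `ℓ_k` as a function on `X`. -/
def superpotentialTerm (k : Fin r) : ((Fin n → ℤ) × (Fin r → ℤ)) →₀ ℂ :=
  (E.sec k).mapDomain fun m => (m, Pi.single k 1)

/-- The section `g` as a function on `X`. -/
def superpotential : ((Fin n → ℤ) × (Fin r → ℤ)) →₀ ℂ := ∑ k, E.superpotentialTerm k

end BundleWithSection

/-! Tori and regular maps, at the level of complex points. -/

/-- The complex points of the torus with character lattice `M`. -/
abbrev Torus (M : Type*) [AddCommGroup M] := AddChar M ℂˣ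

/-- The value at a point of the function with the given expansion in characters. -/
def laurentEval {M : Type*} [AddCommGroup M] (p : M →₀ ℂ) (t : Torus M) : ℂ :=
  p.sum fun χ c => c * (t χ : ℂ)

/-- The points of an affine variety over `ℂ` together with its algebra of regular functions. -/
class HasCoordinateRing (P : Type*) where
  coordRing : Subalgebra ℂ (P → ℂ)

instance instCoordTorus {M : Type*} [AddCommGroup M] : HasCoordinateRing (Torus M) where
  coordRing := Algebra.adjoin ℂ {f | ∃ χ : M, f = fun t => (t χ : ℂ)}

/-- The algebraic torus `𝔾_m^ι`. -/
instance instCoordGm {ι : Type*} : HasCoordinateRing (ι → ℂˣ) where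
  coordRing := Algebra.adjoin ℂ
    ({f | ∃ j : ι, f = fun x => (x j : ℂ)} ∪ {f | ∃ j : ι, f = fun x => ((x j)⁻¹ : ℂˣ).val})

/-- The product of two affine varieties. -/
instance instCoordProd {P Q : Type*} [HasCoordinateRing P] [HasCoordinateRing Q] :
    HasCoordinateRing (P × Q) where
  coordRing := Algebra.adjoin ℂ
    ({f | ∃ g ∈ HasCoordinateRing.coordRing (P := P), f = fun x => g x.1} ∪
      {f | ∃ g ∈ HasCoordinateRing.coordRing (P := Q), f = fun x => g x.2})

/-- `X` is a Zariski open subset of `Z`. -/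
def IsZariskiOpenIn {P : Type*} [HasCoordinateRing P] (X Z : Set P) : Prop :=
  X ⊆ Z ∧ ∀ x ∈ X, ∃ f ∈ HasCoordinateRing.coordRing (P := P),
    f x ≠ 0 ∧ ∀ z ∈ Z, f z ≠ 0 → z ∈ X

/-- A map between subvarieties of affine varieties is regular: each coordinate function pulls
back to a function which is locally, in the Zariski topology, a quotient of coordinate functions. -/
def IsRegularMap {P Q : Type*} [HasCoordinateRing P] [HasCoordinateRing Q]
    {X : Set P} {Y : Set Q} (F : X → Y) : Prop :=
  ∀ g ∈ HasCoordinateRing.coordRing (P := Q), ∀ x : X,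
    ∃ p ∈ HasCoordinateRing.coordRing (P := P), ∃ q ∈ HasCoordinateRing.coordRing (P := P),
      q x.1 ≠ 0 ∧ ∀ y : X, q y.1 ≠ 0 → g (F y).1 = p y.1 / q y.1

/-! Two bundles with sections having the same affinization and the same superpotential. -/

/-- Two toric varieties with split bundles and sections (index `0` and `1` of `side`), whose total
spaces have been identified with one affinization `X⁽⁰⁾` along the common torus `T` with character
lattice `L`: `ident i` identifies `L` with the characters of the torus of `X⁽ⁱ⁾`, the global
characters correspond, and the two sections define the same function. -/
structure MirrorPair (n r : ℕ) (L : Type*) [AddCommGroup L] where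
  side : Fin 2 → BundleWithSection n r
  ident : Fin 2 → (L ≃+ (Fin n → ℤ) × (Fin r → ℤ))
  affinization : ∀ χ : L,
    ident 0 χ ∈ (side 0).globalCharacters ↔ ident 1 χ ∈ (side 1).globalCharacters
  same_superpotential :
    (side 0).superpotential.mapDomain (ident 0).symm =
      (side 1).superpotential.mapDomain (ident 1).symm

namespace MirrorPair

variable {n r : ℕ} {L : Type*} [AddCommGroup L] (P : MirrorPair n r L)

/-- The common superpotential `W = ∑ c_χ χ` on `T`. -/
def W : L →₀ ℂ := (P.side 0).superpotential.mapDomain (P.ident 0).symm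

/-- The function `W_k⁽ⁱ⁾` on `T`. -/
def Wterm (i : Fin 2) (k : Fin r) : L →₀ ℂ :=
  ((P.side i).superpotentialTerm k).mapDomain (P.ident i).symm

/-- `Λ_k⁽ⁱ⁾`, the set of characters in the expansion of `W_k⁽ⁱ⁾`. -/
def charSet (i : Fin 2) (k : Fin r) : Finset L := (P.Wterm i k).support

open Classical in
/-- The matrix `(W)` at a point of `T`, with entries
`W_ab = ∑ c_χ χ` over `χ ∈ Λ_a⁽¹⁾ ∩ Λ_b⁽²⁾`. -/
def matrixW (t : Torus L) : Matrix (Fin r) (Fin r) ℂ :=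
  Matrix.of fun a b => ∑ χ ∈ P.charSet 0 a ∩ P.charSet 1 b, P.W χ * (t χ : ℂ)

/-- The arrows of the directed graph `D`. -/
def arrow (a b : Fin r) : Prop := ∃ χ, χ ∈ P.charSet 0 a ∧ χ ∈ P.charSet 1 b

/-- The set of connected components of `D` (forgetting the directions of arrows). -/
def Component : Type := Quotient (Relation.EqvGen.setoid P.arrow)

/-- The component, or block, of an index. -/
def component (k : Fin r) : P.Component := Quotient.mk (Relation.EqvGen.setoid P.arrow) k

/-- The number `β` of blocks. -/
def blockCount : ℕ := Nat.card P.Component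

/-- The torus `𝔾_m^β`, with one coordinate for each component of `D`. -/
abbrev BlockTorus : Type := P.Component → ℂˣ

/-- First assumption: `Λ_k⁽¹⁾ ∩ Λ_k⁽²⁾ ≠ ∅` for all `k`. -/
def DiagonalNonempty : Prop := ∀ k, ∃ χ, χ ∈ P.charSet 0 k ∧ χ ∈ P.charSet 1 k

/-- The characters of `T` that are pulled back from `T_{Y⁽ⁱ⁾}`. -/
def baseCharacters (i : Fin 2) : AddSubgroup L :=
  ((AddMonoidHom.snd (Fin n → ℤ) (Fin r → ℤ)).comp (P.ident i).toAddMonoidHom).ker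

/-- Second assumption: the ratios of characters in the same `Λ_k⁽ⁱ⁾` generate all characters of
`T_{Y⁽ⁱ⁾}`. -/
def RatiosGenerate : Prop := ∀ i, AddSubgroup.closure
  {χ : L | ∃ k, ∃ χ₁ ∈ P.charSet i k, ∃ χ₂ ∈ P.charSet i k, χ = χ₁ - χ₂} = P.baseCharacters i

/-- The projection `T → T_{Y⁽ⁱ⁾}`. -/
def proj (i : Fin 2) (t : Torus L) : Torus (Fin n → ℤ) :=
  t.compAddMonoidHom ((P.ident i).symm.toAddMonoidHom.comp
    (AddMonoidHom.inl (Fin n → ℤ) (Fin r → ℤ)))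

/-- The part of the complete intersection `Z⁽ⁱ⁾` in the open torus `T_{Y⁽ⁱ⁾}` of `Y⁽ⁱ⁾`; all
points of `T` lie over this torus. -/
def Z (i : Fin 2) : Set (Torus (Fin n → ℤ)) :=
  {y | ∀ k, laurentEval ((P.side i).sec k) y = 0}

/-- The subset `S⁽ⁱ⁾` of `T` lying over `Z⁽ⁱ⁾`. -/
def S (i : Fin 2) : Set (Torus L) := {t | P.proj i t ∈ P.Z i}

/-- The subset `R⁽ⁱ⁾` of `S⁽ⁱ⁾` on which `(W)` has rank `r - β`. -/
def R (i : Fin 2) : Set (Torus L) := {t | t ∈ P.S i ∧ (P.matrixW t).rank + P.blockCount = r}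

/-- `R⁽¹⁾ ∩ R⁽²⁾`. -/
def RR : Set (Torus L) := P.R 0 ∩ P.R 1

/-- `Ω⁽ⁱ⁾`, the image of `R⁽¹⁾ ∩ R⁽²⁾` in `Z⁽ⁱ⁾`. -/
def Omega (i : Fin 2) : Set (Torus (Fin n → ℤ)) := P.proj i '' P.RR

/-- The one-parameter-per-block subgroup of `T` through which `𝔾_m^β` rescales the fibre
coordinates of `X⁽ⁱ⁾ → Y⁽ⁱ⁾`: the coordinates of `Y⁽ⁱ⁾` are kept and the `k`-th fibre coordinate
is multiplied by `lam (component k)`. -/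
def blockScaling (i : Fin 2) : P.BlockTorus →* Torus L where
  toFun lam :=
    { toFun := fun χ => ∏ k, lam (P.component k) ^ ((P.ident i χ).2 k)
      map_zero_eq_one' := by simp
      map_add_eq_mul' := by
        intro χ₁ χ₂
        simp [zpow_add, Finset.prod_mul_distrib] }
  map_one' := by
    ext χ
    simp
  map_mul' lam₁ lam₂ := by
    ext χ
    simp [mul_zpow, Finset.prod_mul_distrib]

end MirrorPair

end

/-! Split `T` by a point `y` of the base torus and fibre coordinates `x`. Seen from side `i`, the
matrix (`(W)` or its transpose) is `diag(x) * B(y)`. It is block diagonal along the components of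
`D`. Its row sums vanish exactly when `y` lies in `Z⁽ⁱ⁾`, and its column sums vanish exactly when
the point lies over the zero locus of the other side, that is, when `x` is in the left kernel of
`B(y)` (`torusLift_mem_RR_iff`). At rank `r - β` this kernel has dimension `β`. It contains all
blockwise rescalings of the nowhere zero `x`, hence consists of them, so the fibres are torsors.

The trivialization needs a kernel vector that is algebraic in `y`. Adding `1` at one diagonal entry
per block gives a matrix whose determinant is nonzero at these points (`det_pinnedMatrix_ne_zero`)
and whose adjugate yields a kernel vector `v(y)`, polynomial in the entries of `B(y)`. Every kernel
vector is then `v / det` rescaled by its values at the representatives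
(`det_mul_eq_rep_mul_leftKernelVector`). These values are the `𝔾_m^β` coordinates, and `Ω⁽ⁱ⁾` is the
locus in `Z⁽ⁱ⁾` where the determinant and all entries of `v` are nonzero.

The two actions agree because both scale each character of `W` by the parameter of its block, and
the assumptions make these characters generate the lattice (`closure_charSet`). -/

/-! ### Block diagonal matrices with zero row sums and their left kernels. -/

section PinnedMatrix

open Matrix

variable {ι C K : Type*} [Fintype ι] [DecidableEq ι] [Field K]
  {A : Matrix ι ι K} {c : ι → C} {s : C → ι}

/-- The indicator function of the representatives `s j` of the blocks. -/
def blockRepIndicator (K : Type*) [Field K] (c : ι → C) (s : C → ι) (k : ι) : K :=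
  if s (c k) = k then 1 else 0

/-- The matrix `A` with `1` added to the diagonal at one representative of each block. -/
def pinnedMatrix (A : Matrix ι ι K) (c : ι → C) (s : C → ι) : Matrix ι ι K :=
  A + Matrix.diagonal (blockRepIndicator K c s)

/-- The sum of the rows of the adjugate of the pinned matrix at the representatives. -/
def leftKernelVector (A : Matrix ι ι K) (c : ι → C) (s : C → ι) : ι → K :=
  blockRepIndicator K c s ᵥ* (pinnedMatrix A c s).adjugate

-- Row `a` only meets its own block, where the function is the constant `lam (c a)`, so a multiple
-- of the row sum remains.
omit [DecidableEq ι] in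
theorem mulVec_comp_block_eq_zero (hA : ∀ a b, c a ≠ c b → A a b = 0) (hrow : A *ᵥ 1 = 0)
    (lam : C → K) : A *ᵥ (fun k => lam (c k)) = 0 := by
  funext a
  have h := congrFun hrow a
  simp only [mulVec, dotProduct, Pi.one_apply, mul_one, Pi.zero_apply] at h ⊢
  rw [← zero_mul (lam (c a)), ← h, Finset.sum_mul]
  refine Finset.sum_congr rfl fun b _ => ?_
  by_cases hab : c a = c b
  · rw [hab]
  · simp [hA a b hab]

omit [DecidableEq ι] in
theorem vecMul_comp_block_mul_eq_zero (hA : ∀ a b, c a ≠ c b → A a b = 0) {x : ι → K}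
    (hx : x ᵥ* A = 0) (lam : C → K) : (fun k => lam (c k) * x k) ᵥ* A = 0 := by
  funext b
  have h := congrFun hx b
  simp only [vecMul, dotProduct, Pi.zero_apply] at h ⊢
  rw [← mul_zero (lam (c b)), ← h, Finset.mul_sum]
  refine Finset.sum_congr rfl fun a _ => ?_
  by_cases hab : c a = c b
  · rw [hab, mul_assoc]
  · simp [hA a b hab]

/-- `A` kills the indicator of a block from the right, so the pairing sees only the pin, which meets
block `j` in `s j` alone. -/
theorem vecMul_pinnedMatrix_dotProduct [DecidableEq C] (hA : ∀ a b, c a ≠ c b → A a b = 0)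
    (hrow : A *ᵥ 1 = 0) (hs : ∀ j, c (s j) = j) (x : ι → K) (j : C) :
    (x ᵥ* pinnedMatrix A c s) ⬝ᵥ (fun k => if c k = j then 1 else 0) = x (s j) := by
  rw [← dotProduct_mulVec, pinnedMatrix, add_mulVec,
    mulVec_comp_block_eq_zero hA hrow (fun l => if l = j then 1 else 0), zero_add]
  simp only [dotProduct, mulVec_diagonal, blockRepIndicator]
  rw [Finset.sum_eq_single (s j)]
  · simp [hs]
  · intro k _ hk
    by_cases h : c k = j
    · subst h
      simp [Ne.symm hk]
    · simp [h]
  · simp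

theorem vecMul_pinnedMatrix (x : ι → K) :
    x ᵥ* pinnedMatrix A c s = x ᵥ* A + fun k => x k * blockRepIndicator K c s k := by
  funext k
  simp [pinnedMatrix, vecMul_add, vecMul_diagonal]

theorem apply_rep_eq_zero_of_vecMul_pinnedMatrix (hA : ∀ a b, c a ≠ c b → A a b = 0)
    (hrow : A *ᵥ 1 = 0) (hs : ∀ j, c (s j) = j) {x : ι → K}
    (hx : x ᵥ* pinnedMatrix A c s = 0) (j : C) : x (s j) = 0 := by
  classical
  rw [← vecMul_pinnedMatrix_dotProduct hA hrow hs x j, hx, zero_dotProduct]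

theorem vecMul_eq_zero_of_vecMul_pinnedMatrix (hA : ∀ a b, c a ≠ c b → A a b = 0)
    (hrow : A *ᵥ 1 = 0) (hs : ∀ j, c (s j) = j) {x : ι → K}
    (hx : x ᵥ* pinnedMatrix A c s = 0) : x ᵥ* A = 0 := by
  rw [vecMul_pinnedMatrix] at hx
  rw [← hx, left_eq_add]
  funext k
  by_cases h : s (c k) = k
  · have := apply_rep_eq_zero_of_vecMul_pinnedMatrix hA hrow hs
      ((vecMul_pinnedMatrix x).trans hx) (c k)
    rw [h] at this
    simp [this]
  · simp [blockRepIndicator, h]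

theorem leftKernelVector_vecMul_pinnedMatrix :
    leftKernelVector A c s ᵥ* pinnedMatrix A c s =
      (pinnedMatrix A c s).det • blockRepIndicator K c s := by
  rw [leftKernelVector, vecMul_vecMul, adjugate_mul, vecMul_smul, vecMul_one]

theorem leftKernelVector_rep (hA : ∀ a b, c a ≠ c b → A a b = 0)
    (hrow : A *ᵥ 1 = 0) (hs : ∀ j, c (s j) = j) (j : C) :
    leftKernelVector A c s (s j) = (pinnedMatrix A c s).det := by
  classical
  rw [← vecMul_pinnedMatrix_dotProduct hA hrow hs (leftKernelVector A c s) j, leftKernelVector_vecMul_pinnedMatrix,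
    smul_dotProduct]
  have : blockRepIndicator K c s ⬝ᵥ (fun k => if c k = j then 1 else 0) = 1 := by
    simp only [dotProduct, blockRepIndicator]
    rw [Finset.sum_eq_single (s j)]
    · simp [hs]
    · intro k _ hk
      by_cases h : c k = j
      · subst h
        simp [Ne.symm hk]
      · simp [h]
    · simp
  rw [this, smul_eq_mul, mul_one]

/-- The vector takes the value `det` at each representative, so the pin alone already accounts for
the product `det • indicator`, and nothing is left for `A`. -/
theorem leftKernelVector_vecMul (hA : ∀ a b, c a ≠ c b → A a b = 0)
    (hrow : A *ᵥ 1 = 0) (hs : ∀ j, c (s j) = j) : leftKernelVector A c s ᵥ* A = 0 := by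
  have h := leftKernelVector_vecMul_pinnedMatrix (A := A) (c := c) (s := s)
  rw [vecMul_pinnedMatrix] at h
  have h' : (fun k => leftKernelVector A c s k * blockRepIndicator K c s k) =
      (pinnedMatrix A c s).det • blockRepIndicator K c s := by
    funext k
    by_cases hk : s (c k) = k
    · have := leftKernelVector_rep hA hrow hs (c k)
      rw [hk] at this
      simp [this]
    · simp [blockRepIndicator, hk]
  rw [h'] at h
  simpa using h

/-- The difference of the two sides lies in the left kernel of `A` and vanishes at the
representatives. The invertible pinned matrix therefore kills it. -/
theorem det_mul_eq_rep_mul_leftKernelVector (hA : ∀ a b, c a ≠ c b → A a b = 0)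
    (hrow : A *ᵥ 1 = 0) (hs : ∀ j, c (s j) = j) (hdet : (pinnedMatrix A c s).det ≠ 0)
    {x : ι → K} (hx : x ᵥ* A = 0) (k : ι) :
    (pinnedMatrix A c s).det * x k = x (s (c k)) * leftKernelVector A c s k := by
  have hz : ((pinnedMatrix A c s).det • x -
      fun k => x (s (c k)) * leftKernelVector A c s k) ᵥ* pinnedMatrix A c s = 0 := by
    rw [vecMul_pinnedMatrix, sub_vecMul, smul_vecMul, hx,
      vecMul_comp_block_mul_eq_zero hA (leftKernelVector_vecMul hA hrow hs) (fun j => x (s j))]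
    funext l
    by_cases hl : s (c l) = l
    · have := leftKernelVector_rep hA hrow hs (c l)
      rw [hl] at this
      simp [this, hl, mul_comm]
    · simp [blockRepIndicator, hl]
  have h := congrFun (eq_zero_of_vecMul_eq_zero hdet hz) k
  simpa [sub_eq_zero] using h

-- The right kernel contains all functions that are constant on blocks, a space of dimension
-- `Fintype.card C`.
omit [DecidableEq ι] in
theorem rank_add_card_le [Fintype C] (hA : ∀ a b, c a ≠ c b → A a b = 0)
    (hrow : A *ᵥ 1 = 0) (hs : ∀ j, c (s j) = j) :
    A.rank + Fintype.card C ≤ Fintype.card ι := by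
  let f : (C → K) →ₗ[K] LinearMap.ker A.mulVecLin :=
    (LinearMap.funLeft K K c).codRestrict _ fun lam => by
      rw [LinearMap.mem_ker, mulVecLin_apply]
      exact mulVec_comp_block_eq_zero hA hrow lam
  have hf : Function.Injective f := by
    intro lam mu h
    funext j
    have := congrFun (congrArg Subtype.val h) (s j)
    simpa [f, LinearMap.funLeft, hs] using this
  have h₁ := LinearMap.finrank_le_finrank_of_injective hf
  have h₂ := A.mulVecLin.finrank_range_add_finrank_ker
  simp only [Module.finrank_fintype_fun_eq_card] at h₁ h₂
  rw [Matrix.rank]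
  omega

omit [DecidableEq ι] in
theorem rank_add_le_add (A B : Matrix ι ι K) : (A + B).rank ≤ A.rank + B.rank := by
  rw [Matrix.rank, Matrix.rank, Matrix.rank, mulVecLin_add]
  exact (Submodule.finrank_mono (LinearMap.range_add_le _ _)).trans
    (Submodule.finrank_add_le_finrank_add_finrank _ _)

theorem rank_blockRepIndicator_le [Fintype C] :
    (Matrix.diagonal (blockRepIndicator K c s)).rank ≤ Fintype.card C := by
  classical
  rw [rank_diagonal]
  refine Fintype.card_le_of_injective (fun k => c k.1) fun k l hkl => ?_
  have hk := k.2
  have hl := l.2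
  simp only [blockRepIndicator, ne_eq, ite_eq_right_iff, one_ne_zero, imp_false, not_not]
    at hk hl
  exact Subtype.ext (hk.symm.trans ((congrArg s hkl).trans hl))

/-- The pin has rank at most the number of blocks, so `A` can fall short of full rank by no more
than that. -/
theorem rank_add_card_eq_of_det_ne_zero [Fintype C] (hA : ∀ a b, c a ≠ c b → A a b = 0)
    (hrow : A *ᵥ 1 = 0) (hs : ∀ j, c (s j) = j) (hdet : (pinnedMatrix A c s).det ≠ 0) :
    A.rank + Fintype.card C = Fintype.card ι := by
  refine le_antisymm (rank_add_card_le hA hrow hs) ?_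
  rw [← rank_of_isUnit (pinnedMatrix A c s)
    ((isUnit_iff_isUnit_det _).2 (isUnit_iff_ne_zero.2 hdet))]
  exact (rank_add_le_add _ _).trans (Nat.add_le_add_left rank_blockRepIndicator_le _)

/-- By dimension the left kernel of `A` consists of the blockwise rescalings of `x`. A vector killed
by the pinned matrix is one of these and vanishes at the representatives, where `x` does not, so
every scale factor is zero. For an `x` with a zero at a representative the conclusion can fail. -/
theorem det_pinnedMatrix_ne_zero [Fintype C] (hA : ∀ a b, c a ≠ c b → A a b = 0)
    (hrow : A *ᵥ 1 = 0) (hs : ∀ j, c (s j) = j) (hrank : A.rank + Fintype.card C = Fintype.card ι)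
    {x : ι → K} (hx : x ᵥ* A = 0) (hx0 : ∀ k, x k ≠ 0) : (pinnedMatrix A c s).det ≠ 0 := by
  intro hdet
  obtain ⟨z, hz0, hz⟩ := exists_vecMul_eq_zero_iff.2 hdet
  apply hz0
  let f : (C → K) →ₗ[K] LinearMap.ker Aᵀ.mulVecLin :=
    ((LinearMap.mulRight K x).comp (LinearMap.funLeft K K c)).codRestrict _ fun lam => by
      rw [LinearMap.mem_ker, mulVecLin_apply, mulVec_transpose]
      exact vecMul_comp_block_mul_eq_zero hA hx lam
  have hfk : ∀ lam k, (f lam).1 k = lam (c k) * x k := fun _ _ => rfl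
  have hf : Function.Injective f := by
    intro lam mu h
    funext j
    have := congrFun (congrArg Subtype.val h) (s j)
    simpa [hfk, hs, hx0] using this
  have hdim : Module.finrank K (C → K) = Module.finrank K (LinearMap.ker Aᵀ.mulVecLin) := by
    have h₂ := Aᵀ.mulVecLin.finrank_range_add_finrank_ker
    have h₃ := rank_transpose A
    rw [Matrix.rank] at h₃
    simp only [Module.finrank_fintype_fun_eq_card] at h₂ ⊢
    omega
  obtain ⟨lam, hlam⟩ := (LinearMap.injective_iff_surjective_of_finrank_eq_finrank hdim).1 hf
    ⟨z, by simpa [mulVec_transpose] using vecMul_eq_zero_of_vecMul_pinnedMatrix hA hrow hs hz⟩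
  have hzk : ∀ k, z k = lam (c k) * x k := fun k => by rw [← hfk, hlam]
  funext k
  have h := apply_rep_eq_zero_of_vecMul_pinnedMatrix hA hrow hs hz (c k)
  rw [hzk, hs] at h
  rw [hzk, (mul_eq_zero.1 h).resolve_right (hx0 _), zero_mul, Pi.zero_apply]

end PinnedMatrix

/-! ### Determinants and adjugates over an algebra of functions. -/

section FunctionMatrices

variable {X : Type*} {S : Subalgebra ℂ (X → ℂ)} {ι : Type*} [Fintype ι] [DecidableEq ι]
  {M : X → Matrix ι ι ℂ}

theorem Subalgebra.fun_sum_mem {α : Type*} {s : Finset α} {f : α → X → ℂ}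
    (h : ∀ a ∈ s, f a ∈ S) : (fun x => ∑ a ∈ s, f a x) ∈ S := by
  convert sum_mem h using 1
  funext x
  simp

theorem Subalgebra.fun_prod_mem {α : Type*} {s : Finset α} {f : α → X → ℂ}
    (h : ∀ a ∈ s, f a ∈ S) : (fun x => ∏ a ∈ s, f a x) ∈ S := by
  convert prod_mem h using 1
  funext x
  simp

theorem Subalgebra.fun_const_mem (z : ℂ) : (fun _ => z) ∈ S := S.algebraMap_mem z

theorem Subalgebra.fun_det_mem (h : ∀ a b, (fun x => M x a b) ∈ S) :
    (fun x => (M x).det) ∈ S := by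
  simp only [Matrix.det_apply']
  exact fun_sum_mem fun σ _ => S.mul_mem (fun_const_mem _) (fun_prod_mem fun a _ => h _ _)

theorem Subalgebra.fun_adjugate_mem (h : ∀ a b, (fun x => M x a b) ∈ S) (a b : ι) :
    (fun x => (M x).adjugate a b) ∈ S := by
  simp only [Matrix.adjugate_apply]
  refine fun_det_mem fun i j => ?_
  by_cases hi : i = b
  · subst hi
    simpa using fun_const_mem _
  · simpa [Matrix.updateRow_ne hi] using h i j

end FunctionMatrices

/-! ### Regular functions, and regularity of maps checked on generators. -/

section RegularFunctions

variable {P Q : Type*} [HasCoordinateRing P] [HasCoordinateRing Q] {X : Set P} {Y : Set Q}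

/-- The algebra of functions on a subset of an affine variety that are locally quotients of
coordinate functions. -/
def regularFunctions (X : Set P) : Subalgebra ℂ (X → ℂ) where
  carrier := {f | ∀ x : X, ∃ p ∈ HasCoordinateRing.coordRing (P := P),
    ∃ q ∈ HasCoordinateRing.coordRing (P := P),
      q x.1 ≠ 0 ∧ ∀ y : X, q y.1 ≠ 0 → f y = p y.1 / q y.1}
  mul_mem' := by
    intro f g hf hg x
    obtain ⟨p, hp, q, hq, hqx, h⟩ := hf x
    obtain ⟨p', hp', q', hq', hqx', h'⟩ := hg x
    refine ⟨p * p', mul_mem hp hp', q * q', mul_mem hq hq', mul_ne_zero hqx hqx',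
      fun y hy => ?_⟩
    obtain ⟨h₁, h₂⟩ := mul_ne_zero_iff.1 hy
    simp [h y h₁, h' y h₂, div_mul_div_comm]
  add_mem' := by
    intro f g hf hg x
    obtain ⟨p, hp, q, hq, hqx, h⟩ := hf x
    obtain ⟨p', hp', q', hq', hqx', h'⟩ := hg x
    refine ⟨p * q' + q * p', add_mem (mul_mem hp hq') (mul_mem hq hp'), q * q', mul_mem hq hq',
      mul_ne_zero hqx hqx', fun y hy => ?_⟩
    obtain ⟨h₁, h₂⟩ := mul_ne_zero_iff.1 hy
    simp [h y h₁, h' y h₂, div_add_div _ _ h₁ h₂]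
  algebraMap_mem' := fun z x => ⟨algebraMap ℂ _ z, Subalgebra.algebraMap_mem _ z, 1, one_mem _,
    one_ne_zero, fun y _ => by simp⟩

theorem restrict_mem_regularFunctions {f : P → ℂ} (hf : f ∈ HasCoordinateRing.coordRing (P := P)) :
    (fun x : X => f x.1) ∈ regularFunctions X :=
  fun _ => ⟨f, hf, 1, one_mem _, one_ne_zero, fun y _ => by simp⟩

theorem inv_mem_regularFunctions {f : X → ℂ} (hf : f ∈ regularFunctions X) (h0 : ∀ x, f x ≠ 0) :
    (fun x => (f x)⁻¹) ∈ regularFunctions X := by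
  intro x
  obtain ⟨p, hp, q, hq, hqx, h⟩ := hf x
  have hpx : p x.1 ≠ 0 := fun hpx => h0 x (by rw [h x hqx, hpx, zero_div])
  refine ⟨q * q, mul_mem hq hq, p * q, mul_mem hp hq, mul_ne_zero hpx hqx, fun y hy => ?_⟩
  obtain ⟨h₁, h₂⟩ := mul_ne_zero_iff.1 hy
  change (f y)⁻¹ = _
  rw [h y h₂, inv_div, Pi.mul_apply, Pi.mul_apply, mul_div_mul_right _ _ h₂]

theorem zpow_mem_regularFunctions {f : X → ℂ} (hf : f ∈ regularFunctions X) (h0 : ∀ x, f x ≠ 0)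
    (m : ℤ) : (fun x => f x ^ m) ∈ regularFunctions X := by
  cases m with
  | ofNat a =>
    simp only [Int.ofNat_eq_natCast, zpow_natCast]
    exact pow_mem hf a
  | negSucc a =>
    simp only [zpow_negSucc]
    exact inv_mem_regularFunctions (pow_mem hf (a + 1)) fun x => pow_ne_zero _ (h0 x)

/-- Pullback of functions along a map. -/
def pullbackAlgHom {A B : Type*} (φ : A → B) : (B → ℂ) →ₐ[ℂ] (A → ℂ) :=
  AlgHom.pi fun a => Pi.evalAlgHom ℂ _ (φ a)

/-- The functions whose pullback lies in `S` form a subalgebra, so characters suffice as test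
functions. -/
theorem torus_pullback_mem {A M : Type*} [AddCommGroup M] {φ : A → Torus M}
    {S : Subalgebra ℂ (A → ℂ)} (h : ∀ χ, (fun a => (φ a χ : ℂ)) ∈ S) {g : Torus M → ℂ}
    (hg : g ∈ HasCoordinateRing.coordRing (P := Torus M)) : (fun a => g (φ a)) ∈ S := by
  have : Algebra.adjoin ℂ {f | ∃ χ : M, f = fun t : Torus M => (t χ : ℂ)} ≤
      S.comap (pullbackAlgHom φ) := by
    rw [Algebra.adjoin_le_iff]
    rintro _ ⟨χ, rfl⟩
    exact h χ
  exact this hg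

theorem gm_pullback_mem {A ι : Type*} {φ : A → ι → ℂˣ} {S : Subalgebra ℂ (A → ℂ)}
    (h : ∀ j, (fun a => (φ a j : ℂ)) ∈ S) (h' : ∀ j, (fun a => (((φ a j)⁻¹ : ℂˣ) : ℂ)) ∈ S)
    {g : (ι → ℂˣ) → ℂ} (hg : g ∈ HasCoordinateRing.coordRing (P := ι → ℂˣ)) :
    (fun a => g (φ a)) ∈ S := by
  have : HasCoordinateRing.coordRing (P := ι → ℂˣ) ≤ S.comap (pullbackAlgHom φ) := by
    refine Algebra.adjoin_le ?_
    rintro _ (⟨j, rfl⟩ | ⟨j, rfl⟩)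
    · exact h j
    · exact h' j
  exact this hg

theorem prod_pullback_mem {A : Type*} {φ : A → P × Q} {S : Subalgebra ℂ (A → ℂ)}
    (h : ∀ g ∈ HasCoordinateRing.coordRing (P := P), (fun a => g (φ a).1) ∈ S)
    (h' : ∀ g ∈ HasCoordinateRing.coordRing (P := Q), (fun a => g (φ a).2) ∈ S)
    {g : P × Q → ℂ} (hg : g ∈ HasCoordinateRing.coordRing (P := P × Q)) :
    (fun a => g (φ a)) ∈ S := by
  have : HasCoordinateRing.coordRing (P := P × Q) ≤ S.comap (pullbackAlgHom φ) := by
    refine Algebra.adjoin_le ?_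
    rintro _ (⟨g, hg, rfl⟩ | ⟨g, hg, rfl⟩)
    · exact h g hg
    · exact h' g hg
  exact this hg

theorem character_mem_coordRing {M : Type*} [AddCommGroup M] (χ : M) :
    (fun t : Torus M => (t χ : ℂ)) ∈ HasCoordinateRing.coordRing (P := Torus M) :=
  Algebra.subset_adjoin ⟨χ, rfl⟩

theorem gm_coordinate_mem_coordRing {ι : Type*} (j : ι) :
    (fun x : ι → ℂˣ => (x j : ℂ)) ∈ HasCoordinateRing.coordRing (P := ι → ℂˣ) :=
  Algebra.subset_adjoin (Or.inl ⟨j, rfl⟩)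

theorem comp_fst_mem_coordRing {g : P → ℂ} (hg : g ∈ HasCoordinateRing.coordRing (P := P)) :
    (fun x : P × Q => g x.1) ∈ HasCoordinateRing.coordRing (P := P × Q) :=
  Algebra.subset_adjoin (Or.inl ⟨g, hg, rfl⟩)

theorem comp_snd_mem_coordRing {g : Q → ℂ} (hg : g ∈ HasCoordinateRing.coordRing (P := Q)) :
    (fun x : P × Q => g x.2) ∈ HasCoordinateRing.coordRing (P := P × Q) :=
  Algebra.subset_adjoin (Or.inr ⟨g, hg, rfl⟩)

end RegularFunctions

/-! ### The common torus with its two fibrations, and the torsor over each base. -/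

noncomputable section
namespace MirrorPair

open Matrix

variable {n r : ℕ} {L : Type*} [AddCommGroup L] (P : MirrorPair n r L)

/-! Characters and the two decompositions of the superpotential. -/

theorem W_eq_sum_Wterm (i : Fin 2) : P.W = ∑ k, P.Wterm i k := by
  have h : P.W = (P.side i).superpotential.mapDomain (P.ident i).symm := by
    fin_cases i
    · rfl
    · exact P.same_superpotential
  rw [h, BundleWithSection.superpotential]
  exact map_sum (Finsupp.mapDomain.addMonoidHom (P.ident i).symm) _ _

theorem degree_of_mem_charSet {i : Fin 2} {k : Fin r} {χ : L} (h : χ ∈ P.charSet i k) :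
    (P.ident i χ).2 = Pi.single k 1 := by
  classical
  obtain ⟨p, hp, rfl⟩ := Finset.mem_image.1 (Finsupp.mapDomain_support h)
  obtain ⟨m, -, rfl⟩ := Finset.mem_image.1 (Finsupp.mapDomain_support hp)
  simp

/-- The fibre degree recovers `k`, so the terms of one side have disjoint supports and nothing
cancels in their sum. -/
theorem Wterm_eq_W {i : Fin 2} {k : Fin r} {χ : L} (h : χ ∈ P.charSet i k) :
    P.Wterm i k χ = P.W χ := by
  rw [W_eq_sum_Wterm P i, Finsupp.finsetSum_apply, Finset.sum_eq_single k]
  · intro l _ hl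
    by_contra h'
    have := P.degree_of_mem_charSet (i := i) (k := l) (Finsupp.mem_support_iff.2 h')
    rw [P.degree_of_mem_charSet h] at this
    have h₁ := congrFun this l
    simp [hl] at h₁
  · simp

theorem exists_mem_charSet {χ : L} (h : P.W χ ≠ 0) (i : Fin 2) : ∃ k, χ ∈ P.charSet i k := by
  rw [W_eq_sum_Wterm P i, Finsupp.finsetSum_apply] at h
  obtain ⟨k, -, hk⟩ := Finset.exists_ne_zero_of_sum_ne_zero h
  exact ⟨k, Finsupp.mem_support_iff.2 hk⟩

theorem exists_mem_charSet_of_mem {i : Fin 2} {k : Fin r} {χ : L} (h : χ ∈ P.charSet i k)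
    (i' : Fin 2) : ∃ l, χ ∈ P.charSet i' l :=
  P.exists_mem_charSet (by rw [← P.Wterm_eq_W h]; exact Finsupp.mem_support_iff.1 h) i'

theorem eq_of_mem_charSet {i : Fin 2} {k l : Fin r} {χ : L} (h : χ ∈ P.charSet i k)
    (h' : χ ∈ P.charSet i l) : k = l := by
  by_contra hkl
  have := congrFun ((P.degree_of_mem_charSet h).symm.trans (P.degree_of_mem_charSet h')) k
  simp [hkl] at this

theorem component_eq_of_mem {i : Fin 2} {a b : Fin r} {χ : L} (h : χ ∈ P.charSet i a)
    (h' : χ ∈ P.charSet i.rev b) : P.component a = P.component b := by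
  refine Quotient.sound ?_
  fin_cases i
  · exact Relation.EqvGen.rel _ _ ⟨χ, h, h'⟩
  · exact Relation.EqvGen.symm _ _ (Relation.EqvGen.rel _ _ ⟨χ, h', h⟩)

instance : Finite P.Component :=
  inferInstanceAs (Finite (Quotient (Relation.EqvGen.setoid P.arrow)))

/-! Blockwise rescaling. -/

theorem blockScaling_apply (i : Fin 2) (lam : P.BlockTorus) (χ : L) :
    P.blockScaling i lam χ = ∏ k, lam (P.component k) ^ ((P.ident i χ).2 k) := rfl

theorem blockScaling_of_degree {i : Fin 2} {k : Fin r} {χ : L}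
    (h : (P.ident i χ).2 = Pi.single k 1) (lam : P.BlockTorus) :
    P.blockScaling i lam χ = lam (P.component k) := by
  rw [blockScaling_apply, h, Finset.prod_eq_single k]
  · simp
  · intro l _ hl
    simp [hl]
  · simp

/-- On each side `χ` is linear in a single fibre coordinate. The indices of these two coordinates
are joined by the arrow that `χ` itself provides. -/
theorem blockScaling_of_mem {i i' : Fin 2} {k : Fin r} {χ : L} (h : χ ∈ P.charSet i k)
    (lam : P.BlockTorus) : P.blockScaling i' lam χ = lam (P.component k) := by
  obtain ⟨l, hl⟩ := P.exists_mem_charSet_of_mem h i'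
  rw [P.blockScaling_of_degree (P.degree_of_mem_charSet hl)]
  obtain rfl | rfl : i' = i ∨ i' = i.rev :=
    (by decide : ∀ i i' : Fin 2, i' = i ∨ i' = i.rev) i i'
  · rw [P.eq_of_mem_charSet hl h]
  · rw [P.component_eq_of_mem h hl]

/-- The characters of the superpotential generate the character lattice of `T`. -/
theorem closure_charSet (h₁ : P.DiagonalNonempty) (h₂ : P.RatiosGenerate) (i : Fin 2) :
    AddSubgroup.closure {χ : L | ∃ k, χ ∈ P.charSet i k} = ⊤ := by
  set H := AddSubgroup.closure {χ : L | ∃ k, χ ∈ P.charSet i k}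
  have hbase : P.baseCharacters i ≤ H := by
    rw [← h₂ i, AddSubgroup.closure_le]
    rintro _ ⟨k, χ₁, hχ₁, χ₂, hχ₂, rfl⟩
    exact H.sub_mem (AddSubgroup.subset_closure ⟨k, hχ₁⟩) (AddSubgroup.subset_closure ⟨k, hχ₂⟩)
  have hne : ∀ k, ∃ χ, χ ∈ P.charSet i k := fun k => by
    obtain ⟨χ, h, h'⟩ := h₁ k
    fin_cases i
    · exact ⟨χ, h⟩
    · exact ⟨χ, h'⟩
  choose e he using hne
  refine (AddSubgroup.eq_top_iff' _).2 fun χ => ?_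
  have hsum : ∑ k, (P.ident i χ).2 k • e k ∈ H :=
    H.sum_mem fun k _ => H.zsmul_mem (AddSubgroup.subset_closure ⟨k, he k⟩) _
  -- Each `e k` has degree one in the `k`-th fibre coordinate and zero in the others, so this
  -- subtraction removes the whole fibre degree of `χ`.
  have hdiff : χ - ∑ k, (P.ident i χ).2 k • e k ∈ P.baseCharacters i := by
    change (P.ident i (χ - ∑ k, (P.ident i χ).2 k • e k)).2 = 0
    rw [map_sub, map_sum, Prod.snd_sub, Prod.snd_sum, sub_eq_zero]
    have hdeg : ∀ k, (P.ident i ((P.ident i χ).2 k • e k)).2 =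
        (P.ident i χ).2 k • Pi.single k 1 := fun k => by
      rw [map_zsmul, ← P.degree_of_mem_charSet (he k)]
      rfl
    rw [Finset.sum_congr rfl fun k _ => hdeg k]
    funext l
    simp [Finset.sum_apply, Pi.single_apply]
  simpa using H.add_mem (hbase hdiff) hsum

theorem blockScaling_eq (h₁ : P.DiagonalNonempty) (h₂ : P.RatiosGenerate) (i i' : Fin 2) :
    P.blockScaling i = P.blockScaling i' := by
  ext lam χ : 2
  have hχ : χ ∈ AddSubgroup.closure {χ : L | ∃ k, χ ∈ P.charSet i k} := by
    rw [P.closure_charSet h₁ h₂]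
    trivial
  induction hχ using AddSubgroup.closure_induction with
  | mem χ h =>
    obtain ⟨k, hk⟩ := h
    rw [P.blockScaling_of_mem hk, P.blockScaling_of_mem hk]
  | zero => simp
  | add χ χ' _ _ h h' => rw [AddChar.map_add_eq_mul, AddChar.map_add_eq_mul, h, h']
  | neg χ _ h => rw [AddChar.map_neg_eq_inv, AddChar.map_neg_eq_inv, h]

/-! The trivialization of `T → T_Y` by the fibre coordinates. -/

/-- The point of `T` with given image in `T_{Y⁽ⁱ⁾}` and given fibre coordinates. -/
def torusLift (i : Fin 2) (y : Torus (Fin n → ℤ)) (x : Fin r → ℂˣ) : Torus L where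
  toFun χ := y (P.ident i χ).1 * ∏ k, x k ^ ((P.ident i χ).2 k)
  map_zero_eq_one' := by simp
  map_add_eq_mul' χ₁ χ₂ := by
    simp [_root_.zpow_add, Finset.prod_mul_distrib, AddChar.map_add_eq_mul, mul_mul_mul_comm]

theorem torusLift_apply (i : Fin 2) (y : Torus (Fin n → ℤ)) (x : Fin r → ℂˣ) (χ : L) :
    P.torusLift i y x χ = y (P.ident i χ).1 * ∏ k, x k ^ ((P.ident i χ).2 k) := rfl

/-- The `k`-th fibre coordinate of `X⁽ⁱ⁾ → Y⁽ⁱ⁾` as a character of `T`. -/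
def fibreCharacter (i : Fin 2) (k : Fin r) : L := (P.ident i).symm (0, Pi.single k 1)

theorem proj_torusLift (i : Fin 2) (y : Torus (Fin n → ℤ)) (x : Fin r → ℂˣ) :
    P.proj i (P.torusLift i y x) = y := by
  ext m
  simp [proj, torusLift_apply]

theorem torusLift_proj (i : Fin 2) (t : Torus L) :
    P.torusLift i (P.proj i t) (fun k => t (P.fibreCharacter i k)) = t := by
  ext χ : 1
  have hχ : χ = (P.ident i).symm ((P.ident i χ).1, 0) +
      ∑ k, (P.ident i χ).2 k • P.fibreCharacter i k := by
    apply (P.ident i).injective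
    rw [map_add, map_sum]
    simp only [map_zsmul, fibreCharacter, AddEquiv.apply_symm_apply]
    refine Prod.ext ?_ ?_
    · simp [Prod.fst_sum]
    · funext l
      simp [Prod.snd_sum, Finset.sum_apply, Pi.single_apply]
  have hsum : ∀ s : Finset (Fin r), t (∑ k ∈ s, (P.ident i χ).2 k • P.fibreCharacter i k) =
      ∏ k ∈ s, t (P.fibreCharacter i k) ^ ((P.ident i χ).2 k) := fun s => by
    induction s using Finset.cons_induction with
    | empty => simp
    | cons a s ha ih =>
      rw [Finset.sum_cons, Finset.prod_cons, AddChar.map_add_eq_mul, ih,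
        AddChar.map_zsmul_eq_zpow]
  conv_rhs => rw [hχ, AddChar.map_add_eq_mul, hsum]
  rfl

theorem torusLift_of_degree {i : Fin 2} {k : Fin r} {χ : L}
    (h : (P.ident i χ).2 = Pi.single k 1) (y : Torus (Fin n → ℤ)) (x : Fin r → ℂˣ) :
    P.torusLift i y x χ = x k * y (P.ident i χ).1 := by
  rw [torusLift_apply, h, Finset.prod_eq_single k, mul_comm]
  · simp
  · intro l _ hl
    simp [hl]
  · simp

/-! The matrix `(W)` as seen from either side. -/

open Classical in
/-- The matrix `(W)` for `i = 0`, its transpose for `i = 1`. -/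
def sideMatrix (i : Fin 2) (t : Torus L) : Matrix (Fin r) (Fin r) ℂ :=
  Matrix.of fun a b => ∑ χ ∈ P.charSet i a ∩ P.charSet i.rev b, P.W χ * (t χ : ℂ)

/-- The matrix of the coefficients of `(W)` with respect to the fibre coordinates of `X⁽ⁱ⁾`. -/
def baseMatrix (i : Fin 2) (y : Torus (Fin n → ℤ)) : Matrix (Fin r) (Fin r) ℂ :=
  P.sideMatrix i (P.torusLift i y 1)

theorem sideMatrix_rev (i : Fin 2) (t : Torus L) :
    P.sideMatrix i.rev t = (P.sideMatrix i t)ᵀ := by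
  classical
  ext a b
  simp only [sideMatrix, of_apply, transpose_apply, Fin.rev_rev]
  refine Finset.sum_congr ?_ fun _ _ => rfl
  ext χ
  simp [and_comm]

theorem rank_sideMatrix (i : Fin 2) (t : Torus L) :
    (P.sideMatrix i t).rank = (P.matrixW t).rank := by
  fin_cases i
  · rfl
  · exact (congrArg Matrix.rank (P.sideMatrix_rev 0 t)).trans (rank_transpose _)

/-- All characters in row `a` are linear in the `a`-th fibre coordinate of side `i` and free of the
others. -/
theorem sideMatrix_torusLift (i : Fin 2) (y : Torus (Fin n → ℤ)) (x : Fin r → ℂˣ) :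
    P.sideMatrix i (P.torusLift i y x) =
      Matrix.diagonal (fun k => (x k : ℂ)) * P.baseMatrix i y := by
  classical
  ext a b
  simp only [baseMatrix, sideMatrix, diagonal_mul, of_apply, Finset.mul_sum]
  refine Finset.sum_congr rfl fun χ hχ => ?_
  have h := P.degree_of_mem_charSet (Finset.mem_inter.1 hχ).1
  rw [P.torusLift_of_degree h, P.torusLift_of_degree h]
  simp [mul_left_comm]

theorem sideMatrix_block (i : Fin 2) (t : Torus L) (a b : Fin r)
    (h : P.component a ≠ P.component b) : P.sideMatrix i t a b = 0 := by
  classical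
  refine Finset.sum_eq_zero fun χ hχ => ?_
  obtain ⟨h', h''⟩ := Finset.mem_inter.1 hχ
  exact (h (P.component_eq_of_mem h' h'')).elim

theorem laurentEval_Wterm (i : Fin 2) (k : Fin r) (t : Torus L) :
    laurentEval (P.Wterm i k) t =
      t (P.fibreCharacter i k) * laurentEval ((P.side i).sec k) (P.proj i t) := by
  rw [laurentEval, Wterm, BundleWithSection.superpotentialTerm, Finsupp.sum_mapDomain_index,
    Finsupp.sum_mapDomain_index, laurentEval, Finsupp.mul_sum]
  · refine Finsupp.sum_congr fun m _ => ?_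
    have : (P.ident i).symm (m, Pi.single k 1) =
        P.fibreCharacter i k + (P.ident i).symm (m, 0) := by
      rw [fibreCharacter, ← map_add]
      simp
    rw [this, AddChar.map_add_eq_mul, Units.val_mul, mul_left_comm]
    rfl
  all_goals simp [add_mul]

/-- Each character of `Λ_a` on side `i` lies in exactly one `Λ_b` of the other side, so the entries
of row `a` partition the expansion of the `a`-th term. -/
theorem sideMatrix_mulVec_one (i : Fin 2) (t : Torus L) (a : Fin r) :
    (P.sideMatrix i t *ᵥ 1) a = laurentEval (P.Wterm i a) t := by
  classical
  simp only [sideMatrix, mulVec, dotProduct, Pi.one_apply, mul_one, of_apply]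
  rw [laurentEval, Finsupp.sum, ← Finset.sum_biUnion]
  · have : (Finset.univ.biUnion fun b => P.charSet i a ∩ P.charSet i.rev b) =
        (P.Wterm i a).support := by
      ext χ
      simp only [Finset.mem_biUnion, Finset.mem_univ, true_and, Finset.mem_inter]
      exact ⟨fun ⟨_, h, _⟩ => h, fun h => (P.exists_mem_charSet_of_mem h i.rev).imp
        fun b hb => ⟨h, hb⟩⟩
    rw [Finset.sum_congr (s₂ := (P.Wterm i a).support) (by convert this) fun _ _ => rfl]
    exact Finset.sum_congr rfl fun χ hχ => by rw [P.Wterm_eq_W hχ]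
  · intro b _ b' _ hb
    refine Finset.disjoint_left.2 fun χ h h' => hb ?_
    exact P.eq_of_mem_charSet (Finset.mem_inter.1 h).2 (Finset.mem_inter.1 h').2

theorem mem_S_iff (i : Fin 2) (t : Torus L) : t ∈ P.S i ↔ P.sideMatrix i t *ᵥ 1 = 0 := by
  simp only [funext_iff, sideMatrix_mulVec_one, laurentEval_Wterm, Pi.zero_apply, mul_eq_zero,
    Units.ne_zero, false_or]
  rfl

theorem mem_S_rev_iff (i : Fin 2) (t : Torus L) :
    t ∈ P.S i.rev ↔ 1 ᵥ* P.sideMatrix i t = 0 := by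
  rw [mem_S_iff, sideMatrix_rev, mulVec_transpose]

theorem mem_RR_iff (i : Fin 2) (t : Torus L) :
    t ∈ P.RR ↔ P.proj i t ∈ P.Z i ∧ 1 ᵥ* P.sideMatrix i t = 0 ∧
      (P.sideMatrix i t).rank + P.blockCount = r := by
  rw [← mem_S_rev_iff, rank_sideMatrix]
  change (t ∈ P.S 0 ∧ _) ∧ (t ∈ P.S 1 ∧ _) ↔ t ∈ P.S i ∧ _
  fin_cases i
  · change _ ↔ t ∈ P.S 0 ∧ t ∈ P.S 1 ∧ _
    tauto
  · change _ ↔ t ∈ P.S 1 ∧ t ∈ P.S 0 ∧ _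
    tauto

theorem baseMatrix_block (i : Fin 2) (y : Torus (Fin n → ℤ)) (a b : Fin r)
    (h : P.component a ≠ P.component b) : P.baseMatrix i y a b = 0 :=
  P.sideMatrix_block i _ a b h

theorem baseMatrix_mulVec_one {i : Fin 2} {y : Torus (Fin n → ℤ)} (hy : y ∈ P.Z i) :
    P.baseMatrix i y *ᵥ 1 = 0 :=
  (P.mem_S_iff i _).1 (by rwa [← P.proj_torusLift i y 1] at hy)

/-- Factoring out the invertible `diag(x)` keeps the rank and turns vanishing column sums into a
linear condition on `x`. The other two conditions involve `y` alone. -/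
theorem torusLift_mem_RR_iff (i : Fin 2) (y : Torus (Fin n → ℤ)) (x : Fin r → ℂˣ) :
    P.torusLift i y x ∈ P.RR ↔ y ∈ P.Z i ∧ (fun k => (x k : ℂ)) ᵥ* P.baseMatrix i y = 0 ∧
      (P.baseMatrix i y).rank + P.blockCount = r := by
  have hdet : IsUnit (Matrix.diagonal (fun k => (x k : ℂ))).det := by
    simp [det_diagonal, Finset.prod_ne_zero_iff]
  have hone : (1 : Fin r → ℂ) ᵥ* Matrix.diagonal (fun k => (x k : ℂ)) = fun k => (x k : ℂ) := by
    funext k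
    simp [vecMul_diagonal]
  rw [P.mem_RR_iff i, proj_torusLift, sideMatrix_torusLift,
    rank_mul_eq_right_of_isUnit_det _ _ hdet, ← vecMul_vecMul, hone]

/-! The kernel vector and the section of `R⁽¹⁾ ∩ R⁽²⁾ → Ω⁽ⁱ⁾`. -/

/-- A representative of a component. -/
def representative (j : P.Component) : Fin r := Quotient.out j

theorem component_representative (j : P.Component) : P.component (P.representative j) = j :=
  Quotient.out_eq j

/-- The determinant of the pinned coefficient matrix. -/
def pinnedDet (i : Fin 2) (y : Torus (Fin n → ℤ)) : ℂ :=
  (pinnedMatrix (P.baseMatrix i y) P.component P.representative).det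

/-- A vector in the left kernel of the coefficient matrix, polynomial in its entries. -/
def kernelVector (i : Fin 2) (y : Torus (Fin n → ℤ)) : Fin r → ℂ :=
  leftKernelVector (P.baseMatrix i y) P.component P.representative

theorem pinnedDet_ne_zero {i : Fin 2} {y : Torus (Fin n → ℤ)} {x : Fin r → ℂˣ}
    (h : P.torusLift i y x ∈ P.RR) : P.pinnedDet i y ≠ 0 := by
  obtain ⟨hy, hx, hr⟩ := (P.torusLift_mem_RR_iff i y x).1 h
  have := Fintype.ofFinite P.Component
  refine det_pinnedMatrix_ne_zero (P.baseMatrix_block i y) (P.baseMatrix_mulVec_one hy)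
    P.component_representative ?_ hx fun k => (x k).ne_zero
  rw [← Nat.card_eq_fintype_card, Fintype.card_fin]
  exact hr

theorem fibreCoordinate_eq {i : Fin 2} {y : Torus (Fin n → ℤ)} {x : Fin r → ℂˣ}
    (h : P.torusLift i y x ∈ P.RR) (k : Fin r) :
    (x k : ℂ) = x (P.representative (P.component k)) *
      (P.kernelVector i y k * (P.pinnedDet i y)⁻¹) := by
  obtain ⟨hy, hx, -⟩ := (P.torusLift_mem_RR_iff i y x).1 h
  have hd := P.pinnedDet_ne_zero h
  have := det_mul_eq_rep_mul_leftKernelVector (P.baseMatrix_block i y)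
    (P.baseMatrix_mulVec_one hy) P.component_representative hd hx k
  rw [← mul_assoc, eq_mul_inv_iff_mul_eq₀ hd, mul_comm]
  exact this

theorem kernelVector_ne_zero {i : Fin 2} {y : Torus (Fin n → ℤ)} {x : Fin r → ℂˣ}
    (h : P.torusLift i y x ∈ P.RR) (k : Fin r) : P.kernelVector i y k ≠ 0 := by
  intro h0
  have := P.fibreCoordinate_eq h k
  rw [h0, zero_mul, mul_zero] at this
  exact (x k).ne_zero this

/-- Converse to `pinnedDet_ne_zero` and `kernelVector_ne_zero`: the kernel vector itself serves as
fibre coordinates, and the nonzero determinant forces the rank. -/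
theorem torusLift_kernelVector_mem_RR {i : Fin 2} {y : Torus (Fin n → ℤ)} (hy : y ∈ P.Z i)
    (hd : P.pinnedDet i y ≠ 0) (hv : ∀ k, P.kernelVector i y k ≠ 0) :
    P.torusLift i y (fun k => Units.mk0 _ (hv k)) ∈ P.RR := by
  have := Fintype.ofFinite P.Component
  refine (P.torusLift_mem_RR_iff i y _).2 ⟨hy, ?_, ?_⟩
  · exact leftKernelVector_vecMul (P.baseMatrix_block i y) (P.baseMatrix_mulVec_one hy)
      P.component_representative
  · have := rank_add_card_eq_of_det_ne_zero (P.baseMatrix_block i y)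
      (P.baseMatrix_mulVec_one hy) P.component_representative hd
    rwa [← Nat.card_eq_fintype_card, Fintype.card_fin] at this

theorem exists_torusLift_of_mem_Omega {i : Fin 2} {y : Torus (Fin n → ℤ)}
    (hy : y ∈ P.Omega i) : ∃ x, P.torusLift i y x ∈ P.RR := by
  obtain ⟨t, ht, rfl⟩ := hy
  exact ⟨_, by rwa [P.torusLift_proj]⟩

theorem baseMatrix_mem_coordRing (i : Fin 2) (a b : Fin r) :
    (fun y => P.baseMatrix i y a b) ∈
      HasCoordinateRing.coordRing (P := Torus (Fin n → ℤ)) := by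
  classical
  have h : ∀ y, P.baseMatrix i y a b = ∑ χ ∈ P.charSet i a ∩ P.charSet i.rev b,
      P.W χ * (y (P.ident i χ).1 : ℂ) := fun y => by
    simp [baseMatrix, sideMatrix, torusLift_apply]
  simp only [h]
  exact Subalgebra.fun_sum_mem fun χ _ =>
    mul_mem (Subalgebra.fun_const_mem _) (character_mem_coordRing _)

theorem pinnedMatrix_mem_coordRing (i : Fin 2) (a b : Fin r) :
    (fun y => pinnedMatrix (P.baseMatrix i y) P.component P.representative a b) ∈
      HasCoordinateRing.coordRing (P := Torus (Fin n → ℤ)) :=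
  add_mem (P.baseMatrix_mem_coordRing i a b) (Subalgebra.fun_const_mem _)

theorem pinnedDet_mem_coordRing (i : Fin 2) :
    P.pinnedDet i ∈ HasCoordinateRing.coordRing (P := Torus (Fin n → ℤ)) :=
  Subalgebra.fun_det_mem (P.pinnedMatrix_mem_coordRing i)

theorem kernelVector_mem_coordRing (i : Fin 2) (k : Fin r) :
    (fun y => P.kernelVector i y k) ∈ HasCoordinateRing.coordRing (P := Torus (Fin n → ℤ)) :=
  Subalgebra.fun_sum_mem (s := Finset.univ) (f := fun l y =>
    blockRepIndicator ℂ P.component P.representative l *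
      (pinnedMatrix (P.baseMatrix i y) P.component P.representative).adjugate l k) fun l _ =>
    mul_mem (Subalgebra.fun_const_mem _)
    (Subalgebra.fun_adjugate_mem (P.pinnedMatrix_mem_coordRing i) l k)

theorem isZariskiOpenIn_Omega (i : Fin 2) : IsZariskiOpenIn (P.Omega i) (P.Z i) := by
  refine ⟨?_, fun y hy => ?_⟩
  · rintro _ ⟨t, ht, rfl⟩
    exact ((P.mem_RR_iff i t).1 ht).1
  · obtain ⟨x, hx⟩ := P.exists_torusLift_of_mem_Omega hy
    -- This function does not depend on the chosen point: its nonvanishing locus in `Z⁽ⁱ⁾` is all of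
    -- `Ω⁽ⁱ⁾`.
    refine ⟨fun y => P.pinnedDet i y * ∏ k, P.kernelVector i y k,
      mul_mem (P.pinnedDet_mem_coordRing i)
        (Subalgebra.fun_prod_mem fun k _ => P.kernelVector_mem_coordRing i k),
      mul_ne_zero (P.pinnedDet_ne_zero hx)
        (Finset.prod_ne_zero_iff.2 fun k _ => P.kernelVector_ne_zero hx k), fun z hz hf => ?_⟩
    obtain ⟨hd, hv⟩ := mul_ne_zero_iff.1 hf
    exact ⟨_, P.torusLift_kernelVector_mem_RR hz hd
      fun k => Finset.prod_ne_zero_iff.1 hv k (Finset.mem_univ k), P.proj_torusLift i z _⟩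

/-! The torsor. -/

theorem blockScaling_mul (i : Fin 2) (lam : P.BlockTorus) (t : Torus L) :
    P.blockScaling i lam * t = P.torusLift i (P.proj i t)
      (fun k => lam (P.component k) * t (P.fibreCharacter i k)) := by
  conv_lhs => rw [← P.torusLift_proj i t]
  ext χ : 1
  simp only [AddChar.mul_apply, torusLift_apply, blockScaling_apply, mul_zpow,
    Finset.prod_mul_distrib]
  rw [mul_left_comm]

theorem proj_blockScaling_mul (i : Fin 2) (lam : P.BlockTorus) (t : Torus L) :
    P.proj i (P.blockScaling i lam * t) = P.proj i t := by
  rw [blockScaling_mul, proj_torusLift]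

theorem blockScaling_mul_mem_RR (i : Fin 2) (lam : P.BlockTorus) {t : Torus L} (ht : t ∈ P.RR) :
    P.blockScaling i lam * t ∈ P.RR := by
  rw [← P.torusLift_proj i t, torusLift_mem_RR_iff] at ht
  rw [blockScaling_mul, torusLift_mem_RR_iff]
  refine ⟨ht.1, ?_, ht.2.2⟩
  simpa using vecMul_comp_block_mul_eq_zero (P.baseMatrix_block i _) ht.2.1
    (fun j => (lam j : ℂ))

/-- A point of `R⁽¹⁾ ∩ R⁽²⁾`, by its image in `Ω⁽ⁱ⁾` and its fibre coordinates at the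
representatives of the components. -/
def torsorMap (i : Fin 2) (t : P.RR) :
    (P.Omega i ×ˢ (Set.univ : Set P.BlockTorus) : Set (Torus (Fin n → ℤ) × P.BlockTorus)) :=
  ⟨(P.proj i t.1, fun j => t.1 (P.fibreCharacter i (P.representative j))),
    ⟨t.1, t.2, rfl⟩, trivial⟩

theorem torsorMap_blockScaling_mul (i : Fin 2) (lam : P.BlockTorus) (t : P.RR)
    (h : P.blockScaling i lam * t.1 ∈ P.RR) :
    (P.torsorMap i ⟨P.blockScaling i lam * t.1, h⟩).1 =
      ((P.torsorMap i t).1.1, lam * (P.torsorMap i t).1.2) := by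
  refine Prod.ext (P.proj_blockScaling_mul i lam t.1) ?_
  funext j
  simp only [torsorMap, AddChar.mul_apply, Pi.mul_apply]
  rw [P.blockScaling_of_degree (k := P.representative j) (by simp [fibreCharacter]),
    component_representative]

/-- This formula recovers `t` from its image, which gives injectivity of `torsorMap` and regularity
of the inverse. -/
theorem fibreCharacter_apply_eq (i : Fin 2) (t : P.RR) (k : Fin r) :
    (t.1 (P.fibreCharacter i k) : ℂ) = (P.torsorMap i t).1.2 (P.component k) *
      (P.kernelVector i (P.torsorMap i t).1.1 k * (P.pinnedDet i (P.torsorMap i t).1.1)⁻¹) := by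
  have ht := t.2
  rw [← P.torusLift_proj i t.1] at ht
  exact P.fibreCoordinate_eq ht k

theorem torsorMap_bijective (i : Fin 2) : Function.Bijective (P.torsorMap i) := by
  constructor
  · intro t t' h
    have hfib : ∀ k, t.1 (P.fibreCharacter i k) = t'.1 (P.fibreCharacter i k) := fun k =>
      Units.ext (by rw [fibreCharacter_apply_eq, h, ← fibreCharacter_apply_eq])
    have hproj : P.proj i t.1 = P.proj i t'.1 := congrArg (fun z => z.1.1) h
    apply Subtype.ext
    rw [← P.torusLift_proj i t.1, ← P.torusLift_proj i t'.1, hproj]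
    simp only [hfib]
  · rintro ⟨⟨y, lam⟩, hy, hlam⟩
    obtain ⟨t, ht, rfl⟩ : ∃ t ∈ P.RR, P.proj i t = y := hy
    -- Any point over `y` is moved to the prescribed coordinates by the quotient of `lam` by its own
    -- coordinates.
    refine ⟨⟨P.blockScaling i (lam * (P.torsorMap i ⟨t, ht⟩).1.2⁻¹) * t,
      P.blockScaling_mul_mem_RR i _ ht⟩, Subtype.ext ?_⟩
    rw [P.torsorMap_blockScaling_mul i _ ⟨t, ht⟩, inv_mul_cancel_right]
    rfl

/-- The trivialization of the torsor `R⁽¹⁾ ∩ R⁽²⁾ → Ω⁽ⁱ⁾`. -/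
def torsorEquiv (i : Fin 2) :
    P.RR ≃ (P.Omega i ×ˢ (Set.univ : Set P.BlockTorus) :
      Set (Torus (Fin n → ℤ) × P.BlockTorus)) :=
  Equiv.ofBijective (P.torsorMap i) (P.torsorMap_bijective i)

theorem isRegularMap_torsorEquiv (i : Fin 2) : IsRegularMap (P.torsorEquiv i) := by
  intro g hg
  change (fun t => g (P.torsorMap i t).1) ∈ regularFunctions P.RR
  refine prod_pullback_mem (fun g hg => ?_) (fun g hg => ?_) hg
  · exact torus_pullback_mem (fun m => restrict_mem_regularFunctions
      (character_mem_coordRing ((P.ident i).symm (m, 0)))) hg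
  · refine gm_pullback_mem (S := regularFunctions P.RR)
      (φ := fun t => (P.torsorMap i t).1.2) (fun j => restrict_mem_regularFunctions
      (character_mem_coordRing (P.fibreCharacter i (P.representative j)))) (fun j => ?_) hg
    have := restrict_mem_regularFunctions (X := P.RR)
      (character_mem_coordRing (-P.fibreCharacter i (P.representative j)))
    simp only [AddChar.map_neg_eq_inv] at this
    exact this

theorem isRegularMap_torsorEquiv_symm (i : Fin 2) : IsRegularMap (P.torsorEquiv i).symm := by
  intro g hg
  set S := regularFunctions (P.Omega i ×ˢ (Set.univ : Set P.BlockTorus) :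
    Set (Torus (Fin n → ℤ) × P.BlockTorus))
  change (fun z => g ((P.torsorEquiv i).symm z).1) ∈ S
  refine torus_pullback_mem (fun χ => ?_) hg
  have hbase : ∀ f ∈ HasCoordinateRing.coordRing (P := Torus (Fin n → ℤ)),
      (fun z : (P.Omega i ×ˢ (Set.univ : Set P.BlockTorus) :
        Set (Torus (Fin n → ℤ) × P.BlockTorus)) => f z.1.1) ∈ S := fun f hf =>
    restrict_mem_regularFunctions (comp_fst_mem_coordRing hf)
  have hfib : ∀ k, (fun z => (((P.torsorEquiv i).symm z).1 (P.fibreCharacter i k) : ℂ)) ∈ S := by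
    intro k
    have h : ∀ z, (((P.torsorEquiv i).symm z).1 (P.fibreCharacter i k) : ℂ) =
        z.1.2 (P.component k) * (P.kernelVector i z.1.1 k * (P.pinnedDet i z.1.1)⁻¹) := by
      intro z
      obtain ⟨t, rfl⟩ := (P.torsorEquiv i).surjective z
      rw [Equiv.symm_apply_apply]
      exact P.fibreCharacter_apply_eq i t k
    simp only [h]
    refine mul_mem (restrict_mem_regularFunctions (comp_snd_mem_coordRing
      (gm_coordinate_mem_coordRing (P.component k)))) (mul_mem
      (hbase _ (P.kernelVector_mem_coordRing i k))
      (inv_mem_regularFunctions (hbase _ (P.pinnedDet_mem_coordRing i)) fun z => ?_))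
    obtain ⟨x, hx⟩ := P.exists_torusLift_of_mem_Omega z.2.1
    exact P.pinnedDet_ne_zero hx
  -- A general character is a base character times integral, possibly negative, powers of the fibre
  -- coordinates, so regularity of the latter is enough.
  have h : ∀ z, (((P.torsorEquiv i).symm z).1 χ : ℂ) = z.1.1 (P.ident i χ).1 *
      ∏ k, (((P.torsorEquiv i).symm z).1 (P.fibreCharacter i k) : ℂ) ^ ((P.ident i χ).2 k) := by
    intro z
    obtain ⟨t, rfl⟩ := (P.torsorEquiv i).surjective z
    rw [Equiv.symm_apply_apply]
    conv_lhs => rw [← P.torusLift_proj i t.1, torusLift_apply]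
    push_cast
    rfl
  simp only [h]
  exact mul_mem (hbase _ (character_mem_coordRing _)) (Subalgebra.fun_prod_mem fun k _ =>
    zpow_mem_regularFunctions (hfib k) (fun z => Units.ne_zero _) _)

theorem isRegularMap_blockScaling (i : Fin 2)
    (hR : ∀ lam : P.BlockTorus, ∀ t ∈ P.RR, P.blockScaling i lam * t ∈ P.RR) :
    IsRegularMap (X := (Set.univ : Set P.BlockTorus) ×ˢ P.RR) (Y := P.RR)
      (fun x => ⟨P.blockScaling i x.1.1 * x.1.2, hR x.1.1 x.1.2 x.2.2⟩) := by
  intro g hg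
  change (fun x : ((Set.univ : Set P.BlockTorus) ×ˢ P.RR : Set (P.BlockTorus × Torus L)) =>
    g (P.blockScaling i x.1.1 * x.1.2)) ∈ regularFunctions _
  refine torus_pullback_mem (fun χ => ?_) hg
  simp only [AddChar.mul_apply, blockScaling_apply, Units.val_mul, Units.coe_prod,
    Units.val_zpow_eq_zpow_val]
  exact mul_mem (Subalgebra.fun_prod_mem fun k _ => zpow_mem_regularFunctions
      (restrict_mem_regularFunctions (comp_fst_mem_coordRing (gm_coordinate_mem_coordRing _)))
      (fun x => Units.ne_zero _) _)
    (restrict_mem_regularFunctions (comp_snd_mem_coordRing (character_mem_coordRing χ)))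

end MirrorPair

end

theorem mainTheorem6 {n r : ℕ} {L : Type*} [AddCommGroup L] (P : MirrorPair n r L)
    (h₁ : P.DiagonalNonempty) (h₂ : P.RatiosGenerate) :
    -- rescaling blockwise means the same from the point of view of both fibrations
    P.blockScaling 0 = P.blockScaling 1 ∧
    -- it preserves `R⁽¹⁾ ∩ R⁽²⁾`, and is an algebraic action there
    ∃ hR : ∀ lam : P.BlockTorus, ∀ t ∈ P.RR, P.blockScaling 0 lam * t ∈ P.RR,
      IsRegularMap (X := (Set.univ : Set P.BlockTorus) ×ˢ P.RR) (Y := P.RR)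
        (fun x => ⟨P.blockScaling 0 x.1.1 * x.1.2, hR x.1.1 x.1.2 x.2.2⟩) ∧
      ∀ i : Fin 2,
        IsZariskiOpenIn (P.Omega i) (P.Z i) ∧
        -- an equivariant isomorphism of varieties over `Ω⁽ⁱ⁾`
        ∃ Φ : P.RR ≃ ((P.Omega i ×ˢ (Set.univ : Set P.BlockTorus) :
            Set (Torus (Fin n → ℤ) × P.BlockTorus))),
          IsRegularMap Φ ∧ IsRegularMap Φ.symm ∧
          (∀ t : P.RR, (Φ t).1.1 = P.proj i t.1) ∧
          ∀ (lam : P.BlockTorus) (t : P.RR),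
            (Φ ⟨P.blockScaling 0 lam * t.1, hR lam t.1 t.2⟩).1 =
              ((Φ t).1.1, lam * (Φ t).1.2) := by
  have heq : ∀ i, P.blockScaling 0 = P.blockScaling i := P.blockScaling_eq h₁ h₂ 0
  refine ⟨heq 1, fun lam t ht => P.blockScaling_mul_mem_RR 0 lam ht,
    P.isRegularMap_blockScaling 0 _, fun i => ⟨P.isZariskiOpenIn_Omega i, P.torsorEquiv i,
      P.isRegularMap_torsorEquiv i, P.isRegularMap_torsorEquiv_symm i, fun _ => rfl,
      fun lam t => ?_⟩⟩
  -- The trivialization of side `i` is equivariant for the scaling of side `i`. Equality of the two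
  -- scalings transfers this to the common action.
  simp only [heq i]
  exact P.torsorMap_blockScaling_mul i lam t _
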